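/- Call a finite graph $G$ \emph{hexagonal} if it is triangle-free and is (isomorphic to) an induced subgraph of the triangular lattice. \textbf{Handles.} Let $G$ be a graph. A \emph{handle} $P(n)$ of $G$ is a path of length $n$ which is an induced subgraph of $G$ and all of whose interior vertices (the vertices of the path other than its end-vertices) have degree $2$ in $G$. A \emph{parity handle} $PP(n)$ is a handle $P(n)$ such that its two end-vertices are joined by another path of $G$ that avoids the interior of the handle and whose length $m$ satisfies $m\le n$ and $m\equiv n \pmod 2$. An \emph{S-handle} $S(n_1,n_2,n_3)$ is a handle of length $n_1$ one of whose end-vertices has degree $3$ in $G$ and is also an end-vertex of two other handles, of lengths $n_2$ and $n_3$. An \emph{H-handle} $H(n_1,n_2,n,n_3,n_4)$ is a handle of length $n$ whose two end-vertices have degree $3$ in $G$, one of them being also an end-vertex of two other handles, of lengths $n_1,n_2$, and the other one being also an end-vertex of two other handles, of lengths $n_3,n_4$. In an S- or H-handle the three, respectively five, paths are pairwise edge-disjoint, and any vertex common to two of them is an end-vertex of both; their outer end-vertices may coincide. The \emph{interior} of a handle is the set of interior vertices of the path itself (for S- and H-handles: of the central path, of length $n_1$, respectively $n$). \textbf{Cores.}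 Let $\mathcal F$ be a family of types of handles. A \emph{core} $\mathsf{core}_{\mathcal F}(G)$ of $G$ is any induced subgraph obtained from $G$ by successively removing a vertex of degree $0$ or $1$, or the interior of a handle of a type in $\mathcal F$ (degrees and handles being taken in the current induced subgraph), until there remains neither a vertex of degree at most $1$ nor a handle of a type in $\mathcal F$. \textbf{Theorem.} Let $G$ be a hexagonal graph. For each of the three families \begin{enumerate} \item $\mathcal F=\{P(2)\}$, \item $\mathcal F=\{P(4),PP(3)\}$, \item $\mathcal F=\{P(6),PP(3),PP(4),PP(5),S(5,2,1),H(1,2,4,2,1)\}$, \end{enumerate} the empty graph is a core of $G$ with respect to $\mathcal F$, and it is the only one: $\mathsf{core}_{\mathcal F}(G)=\emptyset$ whatever the order of the reductions. -/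

import Mathlib

namespace HandleReduction

/-- The triangular lattice. The vertex `(a, b)` stands for the point `a + b * exp (i * π / 3)` of the
plane, so the six neighbours of a point are obtained by adding the six unit vectors of the lattice. -/
def triangularLattice : SimpleGraph (ℤ × ℤ) where
  Adj x y := y - x ∈
    ({(1, 0), (-1, 0), (0, 1), (0, -1), (1, -1), (-1, 1)} : Set (ℤ × ℤ))
  symm := ⟨by
    rintro ⟨a, b⟩ ⟨c, d⟩ h
    simp only [Set.mem_insert_iff, Set.mem_singleton_iff, Prod.mk_sub_mk, Prod.mk.injEq] at h ⊢
    omega⟩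
  loopless := ⟨by
    rintro ⟨a, b⟩ h
    simp [Prod.ext_iff] at h⟩

/-- A hexagonal graph: a finite triangle-free graph that is (isomorphic to) an induced subgraph of
the triangular lattice. -/
def IsHexagonal {V : Type*} (G : SimpleGraph V) : Prop :=
  Finite V ∧ Nonempty (G ↪g triangularLattice) ∧ G.CliqueFree 3

section

variable {V : Type*} {G : SimpleGraph V}

/-- The degree of a vertex, as an extended natural number. -/
noncomputable def deg (G : SimpleGraph V) (v : V) : ℕ∞ := (G.neighborSet v).encard

/-- The interior of a path: its vertices other than its two end-vertices. -/
def interior {u v : V} (p : G.Walk u v) : Set V := {w | w ∈ p.support ∧ w ≠ u ∧ w ≠ v}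

/-- A handle of `G`: a path that is an induced subgraph of `G` and whose interior vertices
have degree two in `G`. -/
def IsHandle {u v : V} (p : G.Walk u v) : Prop :=
  p.IsPath ∧ p.toSubgraph.IsInduced ∧ ∀ w ∈ interior p, deg G w = 2

/-- Two paths have no common edge, and have no common vertex except possibly vertices that are
end-vertices of both. -/
def MeetOnlyAtEnds {u v a b : V} (p : G.Walk u v) (q : G.Walk a b) : Prop :=
  p.edges.Disjoint q.edges ∧
    ∀ w, w ∈ p.support → w ∈ q.support → (w = u ∨ w = v) ∧ (w = a ∨ w = b)

end

/-- The types of handles: handles `P(n)`, parity handles `PP(n)`, S-handles `S(n₁, n₂, n₃)` and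
H-handles `H(n₁, n₂, n, n₃, n₄)`. -/
inductive HandleType : Type
  | P (n : ℕ)
  | PP (n : ℕ)
  | S (n₁ n₂ n₃ : ℕ)
  | H (n₁ n₂ n n₃ n₄ : ℕ)

/-- `HasType p t`: the path `p` from `u` to `v` is a handle of type `t` of `G`. For the types `S` and
`H` it is the central path. -/
def HasType {V : Type*} {G : SimpleGraph V} {u v : V} (p : G.Walk u v) : HandleType → Prop
  | .P n => IsHandle p ∧ p.length = n
  | .PP n => IsHandle p ∧ p.length = n ∧
      ∃ q : G.Walk u v, q ≠ p ∧ q.IsPath ∧ (∀ w ∈ q.support, w ∉ interior p) ∧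
        q.length ≤ n ∧ q.length % 2 = n % 2
  | .S n₁ n₂ n₃ => IsHandle p ∧ p.length = n₁ ∧ deg G u = 3 ∧
      ∃ (a b : V) (q : G.Walk u a) (r : G.Walk u b),
        (IsHandle q ∧ q.length = n₂) ∧ (IsHandle r ∧ r.length = n₃) ∧
        MeetOnlyAtEnds p q ∧ MeetOnlyAtEnds p r ∧ MeetOnlyAtEnds q r
  | .H n₁ n₂ n n₃ n₄ => IsHandle p ∧ p.length = n ∧ deg G u = 3 ∧ deg G v = 3 ∧
      ∃ (a b c d : V) (q₁ : G.Walk u a) (q₂ : G.Walk u b) (q₃ : G.Walk v c) (q₄ : G.Walk v d),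
        (IsHandle q₁ ∧ q₁.length = n₁) ∧ (IsHandle q₂ ∧ q₂.length = n₂) ∧
        (IsHandle q₃ ∧ q₃.length = n₃) ∧ (IsHandle q₄ ∧ q₄.length = n₄) ∧
        MeetOnlyAtEnds p q₁ ∧ MeetOnlyAtEnds p q₂ ∧ MeetOnlyAtEnds p q₃ ∧ MeetOnlyAtEnds p q₄ ∧
        MeetOnlyAtEnds q₁ q₂ ∧ MeetOnlyAtEnds q₁ q₃ ∧ MeetOnlyAtEnds q₁ q₄ ∧
        MeetOnlyAtEnds q₂ q₃ ∧ MeetOnlyAtEnds q₂ q₄ ∧ MeetOnlyAtEnds q₃ q₄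

/-- One reduction step on the induced subgraphs of `G` (given by their vertex sets): in the current
subgraph `G.induce A`, either a vertex of degree 0 or 1 is removed, or the interior of a handle whose
type lies in the family `F` is removed. Degrees and handles are those of the current subgraph. -/
inductive Step {V : Type*} (F : Set HandleType) (G : SimpleGraph V) : Set V → Set V → Prop
  | lowDegree (A : Set V) (v : A) (hv : deg (G.induce A) v ≤ 1) : Step F G A (A \ {v.1})
  | handle (A : Set V) (t : HandleType) (ht : t ∈ F) (u v : A) (p : (G.induce A).Walk u v)
      (hp : HasType p t) : Step F G A (A \ (Subtype.val '' interior p))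

/-- `A` is the vertex set of a core of `G` with respect to `F`: it is reached from `G` by successive
reduction steps, and no vertex of degree 0 or 1 and no handle of `F` remains. -/
def IsCore {V : Type*} (F : Set HandleType) (G : SimpleGraph V) (A : Set V) : Prop :=
  Relation.ReflTransGen (Step F G) Set.univ A ∧ ∀ B, ¬ Step F G A B

end HandleReduction

namespace HandleReduction

/-! ### Induced paths -/

/-! Every induced subgraph of a hexagonal graph is hexagonal, and each reduction strictly shrinks
the vertex set. By `isCore_iff_eq_empty` it therefore suffices that a nonempty hexagonal graph of
minimum degree at least two contains a handle of the family.

In a triangle-free set of lattice points, two neighbours of a point are at angle at least 2π/3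
(`IsSparse.eq_of_adj`). With minimum degree two, every point is either a link (degree 2) or a branch
point (degree 3, neighbours at mutual angles 2π/3). Translate so that the leftmost point of the top
row is the origin (`exists_isTopLeft_embedding`). A branch point has a neighbour in the row above,
so all points of row 0, and those of row -1 with negative first coordinate, are links. The origin
has exactly the neighbours (1, 0) and (0, -1), which already is a P(2).

For the other families one follows the boundary of the graph from this corner. A long run of links
is a P(4) or P(6). A shorter run ends at branch points: either the cycle around the adjacent face
closes up with length twice that of the run, giving a parity handle, or a point missing from that
cycle forces a neighbour of a branch point to be a link, giving an S- or H-handle. For the third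
family the walk at the origin can avoid all handles only if (-1, -2) is a branch point
(`IsIrreducible.branches_below`); a second walk, from there to the left along row -1, then fails too
(`IsIrreducible.not_isTopLeft`). `isIrreducible_range` carries the lattice configurations back to
handles of the graph. -/

/-- The vertices of the list are, in this order, the vertices of an induced path of `G`. -/
def IsInducedPath {V : Type*} (G : SimpleGraph V) : List V → Prop
  | [] => True
  | [_] => True
  | x :: y :: l => G.Adj x y ∧ (∀ z ∈ l, z ≠ x ∧ ¬ G.Adj x z) ∧ IsInducedPath G (y :: l)

instance IsInducedPath.decidable {V : Type*} (G : SimpleGraph V) [DecidableEq V]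
    [DecidableRel G.Adj] : ∀ l, Decidable (IsInducedPath G l)
  | [] => isTrue trivial
  | [_] => isTrue trivial
  | _ :: y :: l =>
    haveI := IsInducedPath.decidable G (y :: l)
    inferInstanceAs (Decidable (_ ∧ _ ∧ _))

section Walks

variable {V W : Type*} {G : SimpleGraph V} {H : SimpleGraph W}

theorem isInducedPath_map (φ : G ↪g H) :
    ∀ l : List V, IsInducedPath H (l.map φ) ↔ IsInducedPath G l
  | [] => Iff.rfl
  | [_] => Iff.rfl
  | x :: y :: l => by
    have ih := isInducedPath_map φ (y :: l)
    simp only [List.map_cons] at ih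
    simp [IsInducedPath, ih, φ.injective.eq_iff]

theorem IsInducedPath.exists_walk {u v : V} {l : List V}
    (h : IsInducedPath G (u :: (l ++ [v]))) :
    ∃ p : G.Walk u v, p.support = u :: (l ++ [v]) ∧ p.IsPath ∧ p.toSubgraph.IsInduced := by
  induction l generalizing u with
  | nil =>
    obtain ⟨huv, -, -⟩ := h
    refine ⟨.cons huv .nil, rfl, by simp [huv.ne], ?_⟩
    intro a ha b hb hab
    simp only [SimpleGraph.Walk.verts_toSubgraph, Set.mem_ofPred_eq, SimpleGraph.Walk.support_cons,
      SimpleGraph.Walk.support_nil, List.mem_cons, List.not_mem_nil, or_false] at ha hb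
    rw [← SimpleGraph.Subgraph.mem_edgeSet, SimpleGraph.Walk.mem_edges_toSubgraph]
    rcases ha with rfl | rfl <;> rcases hb with rfl | rfl <;> simp_all
  | cons w l ih =>
    obtain ⟨huw, hu, h⟩ := h
    obtain ⟨p, hp, hpath, hind⟩ := ih h
    have hmem : ∀ b ∈ p.support, G.Adj u b → b = w := by
      intro b hb hub
      rw [hp, List.mem_cons] at hb
      exact hb.resolve_right fun hb => (hu b hb).2 hub
    refine ⟨.cons huw p, by simp [hp], ?_, ?_⟩
    · rw [SimpleGraph.Walk.cons_isPath_iff]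
      refine ⟨hpath, fun hup => ?_⟩
      rw [hp, List.mem_cons] at hup
      rcases hup with rfl | hup
      · exact huw.ne rfl
      · exact (hu u hup).1 rfl
    · intro a ha b hb hab
      simp only [SimpleGraph.Walk.verts_toSubgraph, Set.mem_ofPred_eq,
        SimpleGraph.Walk.support_cons, List.mem_cons] at ha hb
      rw [← SimpleGraph.Subgraph.mem_edgeSet, SimpleGraph.Walk.mem_edges_toSubgraph,
        SimpleGraph.Walk.edges_cons, List.mem_cons]
      rcases ha with rfl | ha
      · rcases hb with rfl | hb
        · exact absurd rfl hab.ne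
        · exact .inl (by rw [hmem b hb hab])
      · rcases hb with rfl | hb
        · exact .inl (by rw [hmem a ha hab.symm, Sym2.eq_swap])
        · right
          have := hind (by simpa using ha) (by simpa using hb) hab
          rwa [← SimpleGraph.Subgraph.mem_edgeSet, SimpleGraph.Walk.mem_edges_toSubgraph] at this

theorem IsInducedPath.exists_handle {u v : V} {l : List V}
    (h : IsInducedPath G (u :: (l ++ [v]))) (hl : ∀ w ∈ l, deg G w = 2) :
    ∃ p : G.Walk u v, IsHandle p ∧ p.length = l.length + 1 ∧ p.support = u :: (l ++ [v]) := by
  obtain ⟨p, hp, hpath, hind⟩ := h.exists_walk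
  refine ⟨p, ⟨hpath, hind, ?_⟩, ?_, hp⟩
  · rintro w ⟨hw, hwu, hwv⟩
    rw [hp] at hw
    exact hl w (by simpa [hwu, hwv] using hw)
  · have := p.length_support
    rw [hp] at this
    simpa using this.symm

theorem exists_hasType_P {u v : V} {l : List V} (h : IsInducedPath G (u :: (l ++ [v])))
    (hl : ∀ w ∈ l, deg G w = 2) : ∃ p : G.Walk u v, HasType p (.P (l.length + 1)) := by
  obtain ⟨p, hp, hlen, -⟩ := h.exists_handle hl
  exact ⟨p, hp, hlen⟩

/-- Only second paths of the same length as the handle are ever needed: both halves come from an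
even cycle cut at opposite vertices. -/
theorem exists_hasType_PP {u v : V} {l l' : List V} (h : IsInducedPath G (u :: (l ++ [v])))
    (hl : ∀ w ∈ l, deg G w = 2) (h' : IsInducedPath G (u :: (l' ++ [v])))
    (hlen : l.length = l'.length) (hne : l ≠ []) (hd : ∀ w ∈ l, w ∉ l') :
    ∃ p : G.Walk u v, HasType p (.PP (l.length + 1)) := by
  obtain ⟨p, hp, hpl, hps⟩ := h.exists_handle hl
  obtain ⟨q, hqs, hq, -⟩ := h'.exists_walk
  have hql := q.length_support
  rw [hqs] at hql
  simp only [List.length_cons, List.length_append, List.length_nil, zero_add] at hql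
  refine ⟨p, hp, hpl, q, ?_, hq, ?_, by omega, by omega⟩
  · rintro rfl
    rw [hps] at hqs
    obtain ⟨w, hw⟩ := List.exists_mem_of_ne_nil l hne
    have : l = l' := by simpa using hqs
    exact hd w hw (this ▸ hw)
  · rintro w hw ⟨hwp, hwu, hwv⟩
    rw [hps] at hwp
    rw [hqs] at hw
    exact hd w (by simpa [hwu, hwv] using hwp) (by simpa [hwu, hwv] using hw)

/-- A common edge has two common vertices, hence is the edge joining the ends of `p`, and these are
also the ends of `q`. -/
theorem meetOnlyAtEnds_of_support {u v a b : V} {p : G.Walk u v} {q : G.Walk a b}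
    (h : ∀ w, w ∈ p.support → w ∈ q.support → (w = u ∨ w = v) ∧ (w = a ∨ w = b))
    (hadj : ¬ (G.Adj u v ∧ (u = a ∨ u = b) ∧ (v = a ∨ v = b))) : MeetOnlyAtEnds p q := by
  refine ⟨?_, h⟩
  rw [List.disjoint_left]
  intro e hep heq
  induction e with
  | _ x y =>
    have hxy := p.adj_of_mem_edges hep
    have hx := h x (p.fst_mem_support_of_mem_edges hep) (q.fst_mem_support_of_mem_edges heq)
    have hy := h y (p.snd_mem_support_of_mem_edges hep) (q.snd_mem_support_of_mem_edges heq)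
    obtain ⟨rfl | rfl, hx'⟩ := hx <;> obtain ⟨rfl | rfl, hy'⟩ := hy
    · exact hxy.ne rfl
    · exact hadj ⟨hxy, hx', hy'⟩
    · exact hadj ⟨hxy.symm, hy', hx'⟩
    · exact hxy.ne rfl

/-- The induced paths through `w` and `b` stop at `p₄`: `w` is then not adjacent to any `pᵢ`, so `a`
differs from all of them, while `a = v` stays allowed. -/
theorem exists_hasType_S {u p₁ p₂ p₃ p₄ v w a b : V} (hu : deg G u = 3)
    (hl : ∀ x ∈ [p₁, p₂, p₃, p₄], deg G x = 2) (hw : deg G w = 2)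
    (hp : IsInducedPath G [u, p₁, p₂, p₃, p₄, v]) (hwp : IsInducedPath G [w, u, p₁, p₂, p₃, p₄])
    (hbp : IsInducedPath G [b, u, p₁, p₂, p₃, p₄]) (hwb : w ≠ b)
    (ha : IsInducedPath G [u, w, a]) : ∃ p : G.Walk u v, HasType p (.S 5 2 1) := by
  have hb : IsInducedPath G [u, b] := ⟨hbp.1.symm, by simp, trivial⟩
  obtain ⟨p, hp₀, hpl, hps⟩ := IsInducedPath.exists_handle (l := [p₁, p₂, p₃, p₄]) hp hl
  obtain ⟨q, hq₀, hql, hqs⟩ := IsInducedPath.exists_handle (l := [w]) ha (by simpa using hw)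
  obtain ⟨r, hr₀, hrl, hrs⟩ := IsInducedPath.exists_handle (l := []) hb (by simp)
  have := G.adj_comm
  have := G.loopless
  refine ⟨p, hp₀, hpl, hu, a, b, q, r, ⟨hq₀, hql⟩, ⟨hr₀, hrl⟩, ?_, ?_, ?_⟩
  all_goals
    refine meetOnlyAtEnds_of_support (fun x hx hx' => ?_) ?_
    · simp only [hps, hqs, hrs, List.mem_cons, List.cons_append, List.nil_append,
        List.not_mem_nil, or_false] at hx hx'
      simp only [IsInducedPath, List.mem_cons, List.not_mem_nil, or_false] at *
      grind
    · simp only [IsInducedPath, List.mem_cons, List.not_mem_nil, or_false] at *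
      grind

end Walks

/-! ### Geometry of the triangular lattice -/

/-- The six unit vectors of the triangular lattice. -/
def directions : List (ℤ × ℤ) := [(1, 0), (-1, 0), (0, 1), (0, -1), (1, -1), (-1, 1)]

theorem adj_iff {x y : ℤ × ℤ} : triangularLattice.Adj x y ↔ y - x ∈ directions := by
  simp [triangularLattice, directions]

instance : DecidableRel triangularLattice.Adj := fun _ _ => decidable_of_iff _ adj_iff.symm

/-- The neighbour of `x` obtained by turning `y` about `x` by `2π / 3`. -/
def turnLeft (x y : ℤ × ℤ) : ℤ × ℤ := (x.1 - (y.1 - x.1) - (y.2 - x.2), x.2 + (y.1 - x.1))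

/-- The neighbour of `x` obtained by turning `y` about `x` by `-2π / 3`. -/
def turnRight (x y : ℤ × ℤ) : ℤ × ℤ := (x.1 + (y.2 - x.2), x.2 - (y.1 - x.1) - (y.2 - x.2))

/-- The reflection of `y` in `x`. -/
def opposite (x y : ℤ × ℤ) : ℤ × ℤ := (2 * x.1 - y.1, 2 * x.2 - y.2)

/-- Turns commute with translations, so statements about the neighbours of `x` become finite checks
over the six directions. -/
theorem turnLeft_sub (x y : ℤ × ℤ) : turnLeft x y - x = turnLeft 0 (y - x) := by
  ext <;> simp only [turnLeft, Prod.fst_sub, Prod.snd_sub, Prod.fst_zero, Prod.snd_zero] <;> ring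

theorem turnRight_sub (x y : ℤ × ℤ) : turnRight x y - x = turnRight 0 (y - x) := by
  ext <;> simp only [turnRight, Prod.fst_sub, Prod.snd_sub, Prod.fst_zero, Prod.snd_zero] <;> ring

theorem opposite_sub (x y : ℤ × ℤ) : opposite x y - x = opposite 0 (y - x) := by
  ext <;> simp only [opposite, Prod.fst_sub, Prod.snd_sub, Prod.fst_zero, Prod.snd_zero] <;> ring

theorem eq_turn_or_opposite {x y z : ℤ × ℤ} (hy : triangularLattice.Adj x y)
    (hz : triangularLattice.Adj x z) (hne : z ≠ y) (hyz : ¬ triangularLattice.Adj y z) :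
    z = turnLeft x y ∨ z = opposite x y ∨ z = turnRight x y := by
  have key : ∀ d ∈ directions, ∀ e ∈ directions, e ≠ d → e - d ∉ directions →
      e = turnLeft 0 d ∨ e = opposite 0 d ∨ e = turnRight 0 d := by decide
  rw [adj_iff] at hy hz hyz
  have := key _ hy _ hz (by simpa using hne) (by simpa using hyz)
  simpa only [← turnLeft_sub, ← opposite_sub, ← turnRight_sub, sub_left_inj] using this

theorem adj_opposite {x y : ℤ × ℤ} (h : triangularLattice.Adj x y) :
    triangularLattice.Adj x (opposite x y) := by
  rw [adj_iff] at h ⊢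
  rw [opposite_sub]
  exact (by decide : ∀ d ∈ directions, opposite 0 d ∈ directions) _ h

theorem adj_turnLeft {x y : ℤ × ℤ} (h : triangularLattice.Adj x y) :
    triangularLattice.Adj x (turnLeft x y) := by
  rw [adj_iff] at h ⊢
  rw [turnLeft_sub]
  exact (by decide : ∀ d ∈ directions, turnLeft 0 d ∈ directions) _ h

theorem adj_turnRight {x y : ℤ × ℤ} (h : triangularLattice.Adj x y) :
    triangularLattice.Adj x (turnRight x y) := by
  rw [adj_iff] at h ⊢
  rw [turnRight_sub]
  exact (by decide : ∀ d ∈ directions, turnRight 0 d ∈ directions) _ h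

theorem adj_turnLeft_opposite {x y : ℤ × ℤ} (h : triangularLattice.Adj x y) :
    triangularLattice.Adj (turnLeft x y) (opposite x y) := by
  rw [adj_iff] at h ⊢
  rw [← sub_sub_sub_cancel_right _ _ x, opposite_sub, turnLeft_sub]
  exact (by decide : ∀ d ∈ directions, opposite 0 d - turnLeft 0 d ∈ directions) _ h

theorem adj_opposite_turnRight {x y : ℤ × ℤ} (h : triangularLattice.Adj x y) :
    triangularLattice.Adj (opposite x y) (turnRight x y) := by
  rw [adj_iff] at h ⊢
  rw [← sub_sub_sub_cancel_right _ _ x, opposite_sub, turnRight_sub]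
  exact (by decide : ∀ d ∈ directions, turnRight 0 d - opposite 0 d ∈ directions) _ h

theorem turnLeft_ne {x y : ℤ × ℤ} (h : triangularLattice.Adj x y) : turnLeft x y ≠ y := by
  rw [adj_iff] at h
  rw [ne_eq, ← sub_left_inj (a := x), turnLeft_sub]
  exact (by decide : ∀ d ∈ directions, turnLeft 0 d ≠ d) _ h

theorem turnRight_ne {x y : ℤ × ℤ} (h : triangularLattice.Adj x y) : turnRight x y ≠ y := by
  rw [adj_iff] at h
  rw [ne_eq, ← sub_left_inj (a := x), turnRight_sub]
  exact (by decide : ∀ d ∈ directions, turnRight 0 d ≠ d) _ h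

theorem turnLeft_ne_turnRight {x y : ℤ × ℤ} (h : triangularLattice.Adj x y) :
    turnLeft x y ≠ turnRight x y := by
  rw [adj_iff] at h
  rw [ne_eq, ← sub_left_inj (a := x), turnLeft_sub, turnRight_sub]
  exact (by decide : ∀ d ∈ directions, turnLeft 0 d ≠ turnRight 0 d) _ h

@[simp] theorem turnLeft_turnLeft (x y : ℤ × ℤ) : turnLeft x (turnLeft x y) = turnRight x y := by
  simp only [turnLeft, turnRight, Prod.mk.injEq]
  omega

@[simp] theorem turnRight_turnLeft (x y : ℤ × ℤ) : turnRight x (turnLeft x y) = y := by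
  obtain ⟨c, d⟩ := y
  simp only [turnLeft, turnRight, Prod.mk.injEq]
  omega

@[simp] theorem turnLeft_turnRight (x y : ℤ × ℤ) : turnLeft x (turnRight x y) = y := by
  obtain ⟨c, d⟩ := y
  simp only [turnLeft, turnRight, Prod.mk.injEq]
  omega

@[simp] theorem turnRight_turnRight (x y : ℤ × ℤ) : turnRight x (turnRight x y) = turnLeft x y := by
  simp only [turnLeft, turnRight, Prod.mk.injEq]
  omega

/-! ### Triangle-free sets of lattice points with minimum degree two -/

/-- A set of lattice points that induces a triangle-free graph of minimum degree at least two. -/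
structure IsSparse (M : Set (ℤ × ℤ)) : Prop where
  triangle : ∀ {x y z : ℤ × ℤ}, x ∈ M → y ∈ M → z ∈ M → triangularLattice.Adj x y →
    triangularLattice.Adj x z → ¬ triangularLattice.Adj y z
  two_neighbors : ∀ {x : ℤ × ℤ}, x ∈ M → ∃ y ∈ M, ∃ z ∈ M, y ≠ z ∧ triangularLattice.Adj x y ∧
    triangularLattice.Adj x z

/-- A point of `M` with three neighbours in `M`, at mutual angles `2π / 3`. -/
def IsBranch (M : Set (ℤ × ℤ)) (x : ℤ × ℤ) : Prop :=
  x ∈ M ∧ ∃ y ∈ M, triangularLattice.Adj x y ∧ turnLeft x y ∈ M ∧ turnRight x y ∈ M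

/-- A point of `M` that is not a branch point. -/
def IsLink (M : Set (ℤ × ℤ)) (x : ℤ × ℤ) : Prop := x ∈ M ∧ ¬ IsBranch M x

section Sparse

variable {M : Set (ℤ × ℤ)} {x y z w : ℤ × ℤ}

theorem isLink_or_isBranch (hx : x ∈ M) : IsLink M x ∨ IsBranch M x := by
  by_cases h : IsBranch M x
  · exact .inr h
  · exact .inl ⟨hx, h⟩

theorem IsSparse.eq_of_adj (hM : IsSparse M) (hx : x ∈ M) (hy : y ∈ M) (hz : z ∈ M)
    (hxy : triangularLattice.Adj x y) (hxz : triangularLattice.Adj x z) (hne : z ≠ y) :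
    z = turnLeft x y ∨ z = opposite x y ∨ z = turnRight x y :=
  eq_turn_or_opposite hxy hxz hne (hM.triangle hx hy hz hxy hxz)

/-- A walk arriving at `x` from `y` can go on without turning back; this drives all the later walks.
-/
theorem IsSparse.next (hM : IsSparse M) (hx : x ∈ M) (hy : y ∈ M)
    (hxy : triangularLattice.Adj x y) :
    turnLeft x y ∈ M ∨ opposite x y ∈ M ∨ turnRight x y ∈ M := by
  obtain ⟨z, hz, w, hw, hzw, hxz, hxw⟩ := hM.two_neighbors hx
  obtain ⟨v, hv, hxv, hne⟩ : ∃ v ∈ M, triangularLattice.Adj x v ∧ v ≠ y := by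
    by_cases h : z = y
    · exact ⟨w, hw, hxw, fun h' => hzw (h.trans h'.symm)⟩
    · exact ⟨z, hz, hxz, h⟩
  rcases hM.eq_of_adj hx hy hv hxy hxv hne with rfl | rfl | rfl
  exacts [.inl hv, .inr (.inl hv), .inr (.inr hv)]

/-- The neighbour singled out in `IsBranch` is immaterial: turning permutes the three neighbours
cyclically, and a neighbour opposite to one of them would form a triangle with another. -/
theorem IsBranch.turn (h : IsBranch M x) (hM : IsSparse M) (hz : z ∈ M)
    (hxz : triangularLattice.Adj x z) : turnLeft x z ∈ M ∧ turnRight x z ∈ M := by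
  obtain ⟨hx, y, hy, hxy, hl, hr⟩ := h
  by_cases hne : z = y
  · exact hne ▸ ⟨hl, hr⟩
  rcases hM.eq_of_adj hx hy hz hxy hxz hne with rfl | rfl | rfl
  · simp [hy, hr]
  · exact absurd (adj_turnLeft_opposite hxy)
      (hM.triangle hx hl hz (adj_turnLeft hxy) (adj_opposite hxy))
  · simp [hy, hl]

theorem IsBranch.eq_of_adj (h : IsBranch M x) (hM : IsSparse M) (hy : y ∈ M) (hz : z ∈ M)
    (hxy : triangularLattice.Adj x y) (hxz : triangularLattice.Adj x z) (hne : z ≠ y) :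
    z = turnLeft x y ∨ z = turnRight x y := by
  rcases hM.eq_of_adj h.1 hy hz hxy hxz hne with rfl | rfl | rfl
  · exact .inl rfl
  · exact absurd (adj_turnLeft_opposite hxy)
      (hM.triangle h.1 (h.turn hM hy hxy).1 hz (adj_turnLeft hxy) (adj_opposite hxy))
  · exact .inr rfl

theorem IsSparse.isLink_of_left (hM : IsSparse M) (hx : x ∈ M) (hy : y ∈ M)
    (hxy : triangularLattice.Adj x y) (h : turnLeft x y ∉ M) : IsLink M x :=
  ⟨hx, fun hb => h (hb.turn hM hy hxy).1⟩

theorem IsSparse.isLink_of_right (hM : IsSparse M) (hx : x ∈ M) (hy : y ∈ M)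
    (hxy : triangularLattice.Adj x y) (h : turnRight x y ∉ M) : IsLink M x :=
  ⟨hx, fun hb => h (hb.turn hM hy hxy).2⟩

theorem IsSparse.isBranch_of_three (hM : IsSparse M) (hx : x ∈ M) (hy : y ∈ M) (hz : z ∈ M)
    (hw : w ∈ M) (hxy : triangularLattice.Adj x y) (hxz : triangularLattice.Adj x z)
    (hxw : triangularLattice.Adj x w) (hyz : z ≠ y) (hyw : w ≠ y) (hzw : z ≠ w) :
    IsBranch M x := by
  have hz' := hM.eq_of_adj hx hy hz hxy hxz hyz
  have hw' := hM.eq_of_adj hx hy hw hxy hxw hyw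
  have hnot := hM.triangle hx hz hw hxz hxw
  refine ⟨hx, y, hy, hxy, ?_⟩
  rcases hz' with rfl | rfl | rfl <;> rcases hw' with rfl | rfl | rfl
  · exact absurd rfl hzw
  · exact absurd (adj_turnLeft_opposite hxy) hnot
  · exact ⟨hz, hw⟩
  · exact absurd (adj_turnLeft_opposite hxy).symm hnot
  · exact absurd rfl hzw
  · exact absurd (adj_opposite_turnRight hxy) hnot
  · exact ⟨hw, hz⟩
  · exact absurd (adj_opposite_turnRight hxy).symm hnot
  · exact absurd rfl hzw

/-- A link has no third neighbour. -/
theorem IsLink.eq_or_eq (h : IsLink M x) (hM : IsSparse M) (hy : y ∈ M) (hz : z ∈ M) (hw : w ∈ M)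
    (hxy : triangularLattice.Adj x y) (hxz : triangularLattice.Adj x z)
    (hxw : triangularLattice.Adj x w) (hyz : z ≠ y) : w = y ∨ w = z := by
  by_contra! hc
  exact h.2 (hM.isBranch_of_three h.1 hy hz hw hxy hxz hxw hyz hc.1 hc.2.symm)

end Sparse


/-! ### Lattice points that are extremal for the top-left order -/

/-- The origin is the leftmost point of the top row of `M`. -/
structure IsTopLeft (M : Set (ℤ × ℤ)) : Prop where
  zero_mem : ((0, 0) : ℤ × ℤ) ∈ M
  top : ∀ x ∈ M, x.2 ≤ 0
  left : ∀ x ∈ M, x.2 = 0 → 0 ≤ x.1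

section TopLeft

variable {M : Set (ℤ × ℤ)} {x y z w : ℤ × ℤ}

/-- The directions at a branch point form one of two triples, {(1, 0), (-1, 1), (0, -1)} or {(-1,
0), (0, 1), (1, -1)}; each contains an upward one. -/
theorem IsBranch.upper_neighbor (h : IsBranch M x) : x + (0, 1) ∈ M ∨ x + (-1, 1) ∈ M := by
  obtain ⟨-, y, hy, hxy, hl, hr⟩ := h
  have key : ∀ d ∈ directions, ∃ e ∈ [(0, 1), (-1, 1)],
      e = d ∨ e = turnLeft 0 d ∨ e = turnRight 0 d := by decide
  obtain ⟨e, he, h⟩ := key _ (adj_iff.1 hxy)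
  have : x + e ∈ M := by
    rcases h with rfl | rfl | rfl
    · simpa using hy
    · simpa [← turnLeft_sub] using hl
    · simpa [← turnRight_sub] using hr
  simp only [List.mem_cons, List.not_mem_nil, or_false] at he
  rcases he with rfl | rfl
  exacts [.inl this, .inr this]

theorem IsTopLeft.isLink_row_zero (h : IsTopLeft M) {i : ℤ} (hi : ((i, 0) : ℤ × ℤ) ∈ M) :
    IsLink M (i, 0) := by
  refine ⟨hi, fun hb => ?_⟩
  rcases hb.upper_neighbor with h' | h' <;> simpa using h.top _ h'

theorem IsTopLeft.isLink_row_one (h : IsTopLeft M) {i : ℤ} (hi : ((i, -1) : ℤ × ℤ) ∈ M)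
    (hneg : i < 0 := by decide) : IsLink M (i, -1) := by
  refine ⟨hi, fun hb => ?_⟩
  rcases hb.upper_neighbor with h' | h'
  · have := h.left _ h' (by simp)
    simp only [Prod.fst_add] at this
    omega
  · have := h.left _ h' (by simp)
    simp only [Prod.fst_add] at this
    omega

theorem IsTopLeft.not_mem_above (h : IsTopLeft M) {i : ℤ} : ((i, 1) : ℤ × ℤ) ∉ M :=
  fun h' => absurd (h.top _ h') (by simp)

theorem IsTopLeft.not_mem_left (h : IsTopLeft M) {i : ℤ} (hneg : i < 0 := by decide) :
    ((i, 0) : ℤ × ℤ) ∉ M :=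
  fun h' => absurd (h.left _ h' rfl) (by simpa using hneg)

/-- Form for literal coordinates: the three candidates are read off the expected type, and the
geometry is checked by `decide`. -/
theorem IsSparse.next' (hM : IsSparse M) {a b c : ℤ × ℤ} (hx : x ∈ M) (hy : y ∈ M)
    (h : triangularLattice.Adj x y ∧ turnLeft x y = a ∧ opposite x y = b ∧ turnRight x y = c := by
      decide) : a ∈ M ∨ b ∈ M ∨ c ∈ M := by
  obtain ⟨hxy, rfl, rfl, rfl⟩ := h
  exact hM.next hx hy hxy

theorem IsBranch.turn' (hx : IsBranch M x) (hM : IsSparse M) {a b : ℤ × ℤ} (hy : y ∈ M)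
    (h : triangularLattice.Adj x y ∧ turnLeft x y = a ∧ turnRight x y = b := by decide) :
    a ∈ M ∧ b ∈ M := by
  obtain ⟨hxy, rfl, rfl⟩ := h
  exact hx.turn hM hy hxy

theorem IsSparse.isLink_of_not_mem (hM : IsSparse M) (hx : x ∈ M) (hy : y ∈ M) (hz : z ∉ M)
    (h : triangularLattice.Adj x y ∧ (turnLeft x y = z ∨ turnRight x y = z) := by decide) :
    IsLink M x := by
  obtain ⟨hxy, rfl | rfl⟩ := h
  exacts [hM.isLink_of_left hx hy hxy hz, hM.isLink_of_right hx hy hxy hz]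

/-- The left and the two upper neighbours are excluded. So is (1, -1), since every second neighbour
compatible with it is one of those three. -/
theorem IsTopLeft.neighbors_zero (h : IsTopLeft M) (hM : IsSparse M) :
    ((1, 0) : ℤ × ℤ) ∈ M ∧ ((0, -1) : ℤ × ℤ) ∈ M := by
  obtain ⟨y, hy, -, -, -, hxy, -⟩ := hM.two_neighbors h.zero_mem
  simp only [adj_iff, directions, List.mem_cons, List.not_mem_nil, or_false,
    Prod.mk_zero_zero, sub_zero] at hxy
  rcases hxy with rfl | rfl | rfl | rfl | rfl | rfl
  · obtain h' | h' | h' : ((-1, 1) : ℤ × ℤ) ∈ M ∨ (-1, 0) ∈ M ∨ (0, -1) ∈ M :=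
      hM.next' h.zero_mem hy
    exacts [absurd h' h.not_mem_above, absurd h' h.not_mem_left, ⟨hy, h'⟩]
  · exact absurd hy h.not_mem_left
  · exact absurd hy h.not_mem_above
  · obtain h' | h' | h' : ((1, 0) : ℤ × ℤ) ∈ M ∨ (0, 1) ∈ M ∨ (-1, 1) ∈ M :=
      hM.next' h.zero_mem hy
    exacts [⟨h', hy⟩, absurd h' h.not_mem_above, absurd h' h.not_mem_above]
  · obtain h' | h' | h' : ((0, 1) : ℤ × ℤ) ∈ M ∨ (-1, 1) ∈ M ∨ (-1, 0) ∈ M :=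
      hM.next' h.zero_mem hy
    exacts [absurd h' h.not_mem_above, absurd h' h.not_mem_above, absurd h' h.not_mem_left]
  · exact absurd hy h.not_mem_above

/-- A link has no third neighbour; the geometric side conditions are decided. -/
theorem IsLink.no_third (h : IsLink M x) (hM : IsSparse M) (hy : y ∈ M) (hz : z ∈ M) (hw : w ∈ M)
    (hadj : triangularLattice.Adj x y ∧ triangularLattice.Adj x z ∧ triangularLattice.Adj x w := by
      decide)
    (hne : z ≠ y ∧ w ≠ y ∧ w ≠ z := by decide) : False := by
  rcases h.eq_or_eq hM hy hz hw hadj.1 hadj.2.1 hadj.2.2 hne.1 with h | h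
  exacts [hne.2.1 h, hne.2.2 h]

end TopLeft

/-! ### Forbidden configurations of lattice points -/

/-- `M` carries no handle of the types `PP(3)`, `PP(4)`, `PP(5)`, `P(6)`, `S(5, 2, 1)` and
`H(1, 2, 4, 2, 1)`. -/
structure IsIrreducible (M : Set (ℤ × ℤ)) : Prop extends IsSparse M where
  parity_three {u v p₁ p₂ q₁ q₂ : ℤ × ℤ} (hu : u ∈ M) (h₁ : IsLink M p₁) (h₂ : IsLink M p₂)
    (hv : v ∈ M) (k₁ : q₁ ∈ M) (k₂ : q₂ ∈ M)
    (hp : IsInducedPath triangularLattice [u, p₁, p₂, v] := by decide)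
    (hq : IsInducedPath triangularLattice [u, q₁, q₂, v] := by decide)
    (hd : ∀ x ∈ [p₁, p₂], x ∉ [q₁, q₂] := by decide) : False
  parity_four {u v p₁ p₂ p₃ q₁ q₂ q₃ : ℤ × ℤ} (hu : u ∈ M) (h₁ : IsLink M p₁) (h₂ : IsLink M p₂)
    (h₃ : IsLink M p₃) (hv : v ∈ M) (k₁ : q₁ ∈ M) (k₂ : q₂ ∈ M) (k₃ : q₃ ∈ M)
    (hp : IsInducedPath triangularLattice [u, p₁, p₂, p₃, v] := by decide)
    (hq : IsInducedPath triangularLattice [u, q₁, q₂, q₃, v] := by decide)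
    (hd : ∀ x ∈ [p₁, p₂, p₃], x ∉ [q₁, q₂, q₃] := by decide) : False
  parity_five {u v p₁ p₂ p₃ p₄ q₁ q₂ q₃ q₄ : ℤ × ℤ} (hu : u ∈ M) (h₁ : IsLink M p₁)
    (h₂ : IsLink M p₂) (h₃ : IsLink M p₃) (h₄ : IsLink M p₄) (hv : v ∈ M) (k₁ : q₁ ∈ M)
    (k₂ : q₂ ∈ M) (k₃ : q₃ ∈ M) (k₄ : q₄ ∈ M)
    (hp : IsInducedPath triangularLattice [u, p₁, p₂, p₃, p₄, v] := by decide)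
    (hq : IsInducedPath triangularLattice [u, q₁, q₂, q₃, q₄, v] := by decide)
    (hd : ∀ x ∈ [p₁, p₂, p₃, p₄], x ∉ [q₁, q₂, q₃, q₄] := by decide) : False
  handle_six {u v p₁ p₂ p₃ p₄ p₅ : ℤ × ℤ} (hu : u ∈ M) (h₁ : IsLink M p₁) (h₂ : IsLink M p₂)
    (h₃ : IsLink M p₃) (h₄ : IsLink M p₄) (h₅ : IsLink M p₅) (hv : v ∈ M)
    (hp : IsInducedPath triangularLattice [u, p₁, p₂, p₃, p₄, p₅, v] := by decide) : False
  s_handle {u p₁ p₂ p₃ p₄ v w b : ℤ × ℤ} (hu : IsBranch M u) (h₁ : IsLink M p₁) (h₂ : IsLink M p₂)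
    (h₃ : IsLink M p₃) (h₄ : IsLink M p₄) (hv : v ∈ M) (hw : IsLink M w) (hb : b ∈ M)
    (hp : IsInducedPath triangularLattice [u, p₁, p₂, p₃, p₄, v] := by decide)
    (hwp : IsInducedPath triangularLattice [w, u, p₁, p₂, p₃, p₄] := by decide)
    (hbp : IsInducedPath triangularLattice [b, u, p₁, p₂, p₃, p₄] := by decide)
    (hwb : w ≠ b := by decide) : False
  h_handle {u p₁ p₂ p₃ v w b w' b' : ℤ × ℤ} (hu : IsBranch M u) (h₁ : IsLink M p₁)
    (h₂ : IsLink M p₂) (h₃ : IsLink M p₃) (hv : IsBranch M v) (hw : IsLink M w) (hb : b ∈ M)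
    (hw' : IsLink M w') (hb' : b' ∈ M)
    (hp : IsInducedPath triangularLattice [w, u, p₁, p₂, p₃, v, w'] := by decide)
    (hbp : IsInducedPath triangularLattice [b, u, p₁, p₂, p₃, v, w'] := by decide)
    (hbp' : IsInducedPath triangularLattice [w, u, p₁, p₂, p₃, v, b'] := by decide)
    (hne : w ≠ b ∧ w' ≠ b' := by decide) : False

/-! ### The boundary walks at the top-left corner -/

section Corner

variable {M : Set (ℤ × ℤ)}

/-- The lower neighbour of the top-left point is a link. -/
theorem IsIrreducible.isLink_below (hM : IsIrreducible M) (hT : IsTopLeft M) :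
    IsLink M (0, -1) := by
  have hS := hM.toIsSparse
  obtain ⟨h10, ha⟩ := hT.neighbors_zero hS
  refine ⟨ha, fun hbr => ?_⟩
  have x0 := hT.isLink_row_zero hT.zero_mem
  have x1 := hT.isLink_row_zero h10
  obtain ⟨hw, hse⟩ : (-1, -1) ∈ M ∧ (1, -2) ∈ M := hbr.turn' hS x0.1
  -- From the branch point (0, -1), the link (-1, -1) starts a leg of length two and (1, -2) is a
  -- leg of length one. Four links in the direction of the origin would thus give S(5,2,1), so a
  -- branch point must come after two or three links.
  have lw := hT.isLink_row_one hw
  by_cases h20 : (2, 0) ∈ M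
  · have x2 := hT.isLink_row_zero h20
    by_cases h30 : (3, 0) ∈ M
    · have x3 := hT.isLink_row_zero h30
      obtain h | h | h : (4, -1) ∈ M ∨ (4, 0) ∈ M ∨ (3, 1) ∈ M := hS.next' h30 h20
      · exact hM.s_handle hbr x0 x1 x2 x3 h lw hse
      · exact hM.s_handle hbr x0 x1 x2 x3 h lw hse
      · exact hT.not_mem_above h
    obtain hc | h | h : (3, -1) ∈ M ∨ (3, 0) ∈ M ∨ (2, 1) ∈ M := hS.next' h20 h10
    rotate_left
    · exact h30 h
    · exact hT.not_mem_above h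
    rcases isLink_or_isBranch hc with lc | bc
    · obtain h | h | h : (3, -2) ∈ M ∨ (4, -2) ∈ M ∨ (4, -1) ∈ M := hS.next' hc h20
      all_goals exact hM.s_handle hbr x0 x1 x2 lc h lw hse
    obtain ⟨h3, h4⟩ : (3, -2) ∈ M ∧ (4, -1) ∈ M := bc.turn' hS h20
    -- This point would close an 8-cycle, giving PP(4). Without it (3, -2) is a link, which supplies
    -- the second leg of length two for H(1,2,4,2,1).
    by_cases h2 : (2, -2) ∈ M
    · exact hM.parity_four ha x0 x1 x2 hc hse h2 h3
    · exact hM.h_handle hbr x0 x1 x2 bc lw hse (hS.isLink_of_not_mem h3 hc h2) h4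
  obtain hc | h | h : (2, -1) ∈ M ∨ (2, 0) ∈ M ∨ (1, 1) ∈ M := hS.next' h10 x0.1
  rotate_left
  · exact h20 h
  · exact hT.not_mem_above h
  -- This point would close the hexagon around (1, -1).
  by_cases h2 : (2, -2) ∈ M
  · exact hM.parity_three ha x0 x1 hc hse h2
  have lc := hS.isLink_of_not_mem hc h10 h2
  obtain h | hd | hd : (2, -2) ∈ M ∨ (3, -2) ∈ M ∨ (3, -1) ∈ M := hS.next' hc h10
  · exact h2 h
  · rcases isLink_or_isBranch hd with ld | bd
    · obtain h | h | h : (3, -3) ∈ M ∨ (4, -3) ∈ M ∨ (4, -2) ∈ M := hS.next' hd hc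
      all_goals exact hM.s_handle hbr x0 x1 lc ld h lw hse
    obtain ⟨h3, h4⟩ : (3, -3) ∈ M ∧ (4, -2) ∈ M := bd.turn' hS hc
    by_cases h5 : (2, -3) ∈ M
    · exact hM.parity_four ha x0 x1 lc hd hse h5 h3
    · exact hM.h_handle hbr x0 x1 lc bd lw hse (hS.isLink_of_not_mem h3 hd h5) h4
  · rcases isLink_or_isBranch hd with ld | bd
    · obtain h | h | h : (4, -2) ∈ M ∨ (4, -1) ∈ M ∨ (3, 0) ∈ M := hS.next' hd hc
      all_goals exact hM.s_handle hbr x0 x1 lc ld h lw hse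
    obtain ⟨h3, h4⟩ : (4, -2) ∈ M ∧ (3, 0) ∈ M := bd.turn' hS hc
    exact hM.h_handle hbr x0 x1 lc bd lw hse (hT.isLink_row_zero h4) h3

/-- The top row starts with exactly two points. -/
theorem IsIrreducible.two_zero_not_mem (hM : IsIrreducible M) (hT : IsTopLeft M) :
    (2, 0) ∉ M := by
  intro h20
  have hS := hM.toIsSparse
  have la := hM.isLink_below hT
  have x0 := hT.isLink_row_zero hT.zero_mem
  have x1 := hT.isLink_row_zero (hT.neighbors_zero hS).1
  have x2 := hT.isLink_row_zero h20
  -- The points (0, -1), (0, 0), (1, 0), (2, 0) are four consecutive links; a fifth at either end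
  -- makes a P(6), so both ends of the run are branch points.
  have ha' : (-1, -1) ∈ M ∨ (0, -2) ∈ M ∨ (1, -2) ∈ M := hS.next' la.1 x0.1
  obtain hc | h30 | h : (3, -1) ∈ M ∨ (3, 0) ∈ M ∨ (2, 1) ∈ M := hS.next' h20 x1.1
  rotate_left
  · have x3 := hT.isLink_row_zero h30
    obtain h | h | h : (4, -1) ∈ M ∨ (4, 0) ∈ M ∨ (3, 1) ∈ M := hS.next' h30 h20
    rotate_right
    · exact hT.not_mem_above h
    all_goals rcases ha' with h' | h' | h'
    all_goals exact hM.handle_six h' la x0 x1 x2 x3 h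
  · exact hT.not_mem_above h
  rcases isLink_or_isBranch hc with lc | bc
  · obtain h | h | h : (3, -2) ∈ M ∨ (4, -2) ∈ M ∨ (4, -1) ∈ M := hS.next' hc h20
    all_goals rcases ha' with h' | h' | h'
    all_goals exact hM.handle_six h' la x0 x1 x2 lc h
  obtain ⟨h3, h4⟩ : (3, -2) ∈ M ∧ (4, -1) ∈ M := bc.turn' hS h20
  rcases ha' with ha' | ha' | ha'
  · have la' := hT.isLink_row_one ha'
    obtain h | h | h : (-2, 0) ∈ M ∨ (-2, -1) ∈ M ∨ (-1, -2) ∈ M := hS.next' ha' la.1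
    · exact absurd h hT.not_mem_left
    all_goals exact hM.handle_six h la' la x0 x1 x2 hc
  · rcases isLink_or_isBranch ha' with la' | ba'
    · obtain h | h | h : (-1, -2) ∈ M ∨ (0, -3) ∈ M ∨ (1, -3) ∈ M := hS.next' ha' la.1
      all_goals exact hM.handle_six h la' la x0 x1 x2 hc
    obtain ⟨h5, h6⟩ : (-1, -2) ∈ M ∧ (1, -3) ∈ M := ba'.turn' hS la.1
    -- A link next to either end gives S(5,2,1) from that end. If (3, -2) and (1, -3) are both
    -- branch points, a 10-cycle closes up and the run is a PP(5).
    rcases isLink_or_isBranch h3 with l3 | b3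
    · exact hM.s_handle bc x2 x1 x0 la ha' l3 h4
    rcases isLink_or_isBranch h6 with l6 | b6
    · exact hM.s_handle ba' la x0 x1 x2 hc l6 h5
    obtain ⟨h7, -⟩ : (2, -2) ∈ M ∧ (4, -3) ∈ M := b3.turn' hS hc
    obtain ⟨-, h8⟩ : (1, -4) ∈ M ∧ (2, -3) ∈ M := b6.turn' hS ha'
    exact hM.parity_five ha' la x0 x1 x2 hc h6 h8 h7 h3
  · rcases isLink_or_isBranch ha' with la' | ba'
    · obtain h | h | h : (1, -3) ∈ M ∨ (2, -3) ∈ M ∨ (2, -2) ∈ M := hS.next' ha' la.1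
      all_goals exact hM.handle_six h la' la x0 x1 x2 hc
    obtain ⟨-, h6⟩ : (1, -3) ∈ M ∧ (2, -2) ∈ M := ba'.turn' hS la.1
    -- The handle is cut off at the link (0, -1): handle ends may have degree two, and the 8-cycle
    -- is halved there.
    exact hM.parity_four la.1 x0 x1 x2 hc ha' h6 h3

/-- Below the top-left point there are two more points in a straight line, and the left neighbour
of the second one is a branch point. -/
theorem IsIrreducible.branches_below (hM : IsIrreducible M) (hT : IsTopLeft M) :
    (0, -2) ∈ M ∧ IsBranch M (-1, -2) := by
  have hS := hM.toIsSparse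
  have h20 := hM.two_zero_not_mem hT
  have la := hM.isLink_below hT
  have x0 := hT.isLink_row_zero hT.zero_mem
  have x1 := hT.isLink_row_zero (hT.neighbors_zero hS).1
  obtain hc | h | h : (2, -1) ∈ M ∨ (2, 0) ∈ M ∨ (1, 1) ∈ M := hS.next' x1.1 x0.1
  rotate_left
  · exact absurd h h20
  · exact absurd h hT.not_mem_above
  have hd : (2, -2) ∈ M ∨ (3, -2) ∈ M ∨ (3, -1) ∈ M := hS.next' hc x1.1
  obtain ha' | ha' | ha' : (-1, -1) ∈ M ∨ (0, -2) ∈ M ∨ (1, -2) ∈ M := hS.next' la.1 x0.1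
  · exfalso
    have la' := hT.isLink_row_one ha'
    have hv : (-2, 0) ∈ M ∨ (-2, -1) ∈ M ∨ (-1, -2) ∈ M := hS.next' ha' la.1
    replace hv := hv.resolve_left hT.not_mem_left
    rcases isLink_or_isBranch hc with lc | bc
    · rcases hv with hv | hv
      all_goals rcases hd with hd | hd | hd
      all_goals exact hM.handle_six hv la' la x0 x1 lc hd
    obtain ⟨h5, h6⟩ : (2, -2) ∈ M ∧ (3, -1) ∈ M := bc.turn' hS x1.1
    have l5 : IsLink M (2, -2) := hS.isLink_of_not_mem h5 hc
      (z := (1, -2)) fun h => la.no_third hS x0.1 ha' h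
    rcases hv with hv | hv
    all_goals exact hM.s_handle bc x1 x0 la la' hv l5 h6
  · have h12 : (1, -2) ∉ M := fun h => la.no_third hS x0.1 ha' h
    refine ⟨ha', ?_⟩
    have hv : (-1, -2) ∈ M ∨ (0, -3) ∈ M ∨ (1, -3) ∈ M := hS.next' ha' la.1
    rcases isLink_or_isBranch hc with lc | bc
    · rcases isLink_or_isBranch ha' with la' | ba'
      · exfalso
        rcases hv with hv | hv | hv
        all_goals rcases hd with hd | hd | hd
        all_goals exact hM.handle_six hv la' la x0 x1 lc hd
      obtain ⟨hy, h7⟩ : (-1, -2) ∈ M ∧ (1, -3) ∈ M := ba'.turn' hS la.1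
      -- Were (-1, -2) a link, it would start the leg of length two of an S-handle centred at (0,
      -- -2).
      refine (isLink_or_isBranch hy).resolve_left fun ly => ?_
      rcases hd with hd | hd | hd
      all_goals exact hM.s_handle ba' la x0 x1 lc hd ly h7
    · obtain ⟨h5, h6⟩ : (2, -2) ∈ M ∧ (3, -1) ∈ M := bc.turn' hS x1.1
      have l5 : IsLink M (2, -2) := hS.isLink_of_not_mem h5 hc h12
      rcases isLink_or_isBranch ha' with la' | ba'
      · exfalso
        rcases hv with hv | hv | hv
        all_goals exact hM.s_handle bc x1 x0 la la' hv l5 h6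
      obtain ⟨hy, h7⟩ : (-1, -2) ∈ M ∧ (1, -3) ∈ M := ba'.turn' hS la.1
      exact (isLink_or_isBranch hy).resolve_left fun ly =>
        hM.h_handle ba' la x0 x1 bc ly h7 l5 h6
  · exfalso
    -- Again the hexagon around (1, -1): it closes with (2, -2), and otherwise both (1, -2) and (2,
    -- -1) are links and extend the run to a P(6).
    by_cases h2 : (2, -2) ∈ M
    · exact hM.parity_three la.1 x0 x1 hc ha' h2
    have lc := hS.isLink_of_not_mem hc x1.1 h2
    have la' := hS.isLink_of_not_mem ha' la.1 h2
    replace hd := hd.resolve_left h2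
    obtain h | h | h : (1, -3) ∈ M ∨ (2, -3) ∈ M ∨ (2, -2) ∈ M := hS.next' ha' la.1
    rotate_right
    · exact h2 h
    all_goals rcases hd with hd | hd
    all_goals exact hM.handle_six h la' la x0 x1 lc hd

/-- The origin is not the leftmost point of the top row of an irreducible set. -/
theorem IsIrreducible.not_isTopLeft (hM : IsIrreducible M) : ¬ IsTopLeft M := by
  intro hT
  have hS := hM.toIsSparse
  obtain ⟨hb, br⟩ := hM.branches_below hT
  -- The second walk leaves the branch point (-1, -2) through (-2, -1). There (0, -2) serves as the
  -- leg of length one, and (-1, -3), when it is a link, starts the leg of length two.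
  obtain ⟨hp, hy'⟩ : (-2, -1) ∈ M ∧ (-1, -3) ∈ M := br.turn' hS hb
  have hy := br.1
  have lp := hT.isLink_row_one hp
  obtain h | h | hq : (-2, 0) ∈ M ∨ (-3, 0) ∈ M ∨ (-3, -1) ∈ M := hS.next' hp hy
  · exact absurd h hT.not_mem_left
  · exact absurd h hT.not_mem_left
  have lq := hT.isLink_row_one hq
  obtain h | hr | hz : (-4, 0) ∈ M ∨ (-4, -1) ∈ M ∨ (-3, -2) ∈ M := hS.next' hq hp
  · exact absurd h hT.not_mem_left
  · have lr := hT.isLink_row_one hr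
    obtain h | hs | hv : (-5, 0) ∈ M ∨ (-5, -1) ∈ M ∨ (-4, -2) ∈ M := hS.next' hr hq
    · exact absurd h hT.not_mem_left
    · have ls := hT.isLink_row_one hs
      obtain h | h | h : (-6, 0) ∈ M ∨ (-6, -1) ∈ M ∨ (-5, -2) ∈ M := hS.next' hs hr
      · exact absurd h hT.not_mem_left
      · obtain h' | h' | h' : (-7, 0) ∈ M ∨ (-7, -1) ∈ M ∨ (-6, -2) ∈ M := hS.next' h hs
        · exact absurd h' hT.not_mem_left
        all_goals exact hM.handle_six hy lp lq lr ls (hT.isLink_row_one h) h'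
      · rcases isLink_or_isBranch h with l | b
        · obtain h' | h' | h' : (-6, -2) ∈ M ∨ (-5, -3) ∈ M ∨ (-4, -3) ∈ M := hS.next' h hs
          all_goals exact hM.handle_six hy lp lq lr ls l h'
        obtain ⟨h1, h2⟩ : (-6, -2) ∈ M ∧ (-4, -3) ∈ M := b.turn' hS hs
        -- The two ends of this run of four links are branch points: a link beside one of them gives
        -- S(5,2,1), otherwise the 10-cycle closes.
        rcases isLink_or_isBranch h2 with l2 | b2
        · exact hM.s_handle b ls lr lq lp hy l2 h1
        rcases isLink_or_isBranch hy' with ly' | by'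
        · exact hM.s_handle br lp lq lr ls h ly' hb
        obtain ⟨h3, -⟩ : (-2, -3) ∈ M ∧ (0, -4) ∈ M := by'.turn' hS hy
        obtain ⟨-, h4⟩ : (-4, -4) ∈ M ∧ (-3, -3) ∈ M := b2.turn' hS h
        exact hM.parity_five hy lp lq lr ls h hy' h3 h4 h2
    · have hv' : (-5, -2) ∈ M ∨ (-4, -3) ∈ M ∨ (-3, -3) ∈ M := hS.next' hv hr
      rcases isLink_or_isBranch hv with lv | bv
      · rcases isLink_or_isBranch hy' with ly' | by'
        · rcases hv' with h | h | h
          all_goals exact hM.s_handle br lp lq lr lv h ly' hb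
        obtain ⟨h3, -⟩ : (-2, -3) ∈ M ∧ (0, -4) ∈ M := by'.turn' hS hy
        rcases hv' with h | h | h
        · rcases isLink_or_isBranch h with l | b
          · obtain h' | h' | h' : (-6, -1) ∈ M ∨ (-6, -2) ∈ M ∨ (-5, -3) ∈ M := hS.next' h hv
            all_goals exact hM.handle_six hy lp lq lr lv l h'
          obtain ⟨h1, h2⟩ : (-6, -1) ∈ M ∧ (-5, -3) ∈ M := b.turn' hS hv
          exact hM.s_handle b lv lr lq lp hy (hT.isLink_row_one h1) h2
        · rcases isLink_or_isBranch h with l | b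
          · obtain h' | h' | h' : (-5, -3) ∈ M ∨ (-4, -4) ∈ M ∨ (-3, -4) ∈ M := hS.next' h hv
            all_goals exact hM.handle_six hy lp lq lr lv l h'
          obtain ⟨h1, h2⟩ : (-5, -3) ∈ M ∧ (-3, -4) ∈ M := b.turn' hS hv
          rcases isLink_or_isBranch h2 with l2 | b2
          · exact hM.s_handle b lv lr lq lp hy l2 h1
          obtain ⟨-, h4⟩ : (-3, -5) ∈ M ∧ (-2, -4) ∈ M := b2.turn' hS h
          exact hM.parity_five hy lp lq lr lv h hy' h3 h4 h2
        · exact hM.parity_four hy lp lq lr hv hy' h3 h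
      · obtain ⟨h1, h2⟩ : (-5, -2) ∈ M ∧ (-3, -3) ∈ M := bv.turn' hS hr
        -- This point closes an 8-cycle; its absence makes both (-1, -3) and (-3, -3) links, as an
        -- H-handle requires.
        by_cases h3 : (-2, -3) ∈ M
        · exact hM.parity_four hy lp lq lr hv hy' h3 h2
        · exact hM.h_handle br lp lq lr bv (hS.isLink_of_not_mem hy' hy h3) hb
            (hS.isLink_of_not_mem h2 hv h3) h1
  -- Here the face is the hexagon around (-2, -2), closed by (-2, -3).
  · by_cases h3 : (-2, -3) ∈ M
    · exact hM.parity_three hy lp lq hz hy' h3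
    have ly' := hS.isLink_of_not_mem hy' hy h3
    have lz := hS.isLink_of_not_mem hz hq h3
    obtain h | h | h : (-4, -2) ∈ M ∨ (-3, -3) ∈ M ∨ (-2, -3) ∈ M := hS.next' hz hq
    · rcases isLink_or_isBranch h with l | b
      · obtain h' | h' | h' : (-5, -1) ∈ M ∨ (-5, -2) ∈ M ∨ (-4, -3) ∈ M := hS.next' h hz
        all_goals exact hM.s_handle br lp lq lz l h' ly' hb
      obtain ⟨h1, h2⟩ : (-5, -1) ∈ M ∧ (-4, -3) ∈ M := b.turn' hS hz
      exact hM.h_handle br lp lq lz b ly' hb (hT.isLink_row_one h1) h2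
    · rcases isLink_or_isBranch h with l | b
      · obtain h' | h' | h' : (-4, -3) ∈ M ∨ (-3, -4) ∈ M ∨ (-2, -4) ∈ M := hS.next' h hz
        all_goals exact hM.s_handle br lp lq lz l h' ly' hb
      obtain ⟨h1, h2⟩ : (-4, -3) ∈ M ∧ (-2, -4) ∈ M := b.turn' hS hz
      by_cases h4 : (-1, -4) ∈ M
      · exact hM.parity_four hy lp lq lz h hy' h4 h2
      · exact hM.h_handle br lp lq lz b ly' hb (hS.isLink_of_not_mem h2 h h4) h1
    · exact h3 h

end Corner


/-! ### H-handles from induced paths -/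

section Walks

variable {V : Type*} {G : SimpleGraph V}

/-- The inner vertices `w`, `w'` must be distinct and non-adjacent, whereas `b` and `b'`, or `a` and
`a'`, may coincide, being outer ends. -/
theorem exists_hasType_H {u p₁ p₂ p₃ v w a b w' a' b' : V} (hu : deg G u = 3) (hv : deg G v = 3)
    (hl : ∀ x ∈ [p₁, p₂, p₃], deg G x = 2) (hw : deg G w = 2) (hw' : deg G w' = 2)
    (hp : IsInducedPath G [w, u, p₁, p₂, p₃, v, w'])
    (hbp : IsInducedPath G [b, u, p₁, p₂, p₃, v, w'])
    (hbp' : IsInducedPath G [w, u, p₁, p₂, p₃, v, b']) (hwb : w ≠ b) (hwb' : w' ≠ b')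
    (ha : IsInducedPath G [u, w, a]) (ha' : IsInducedPath G [v, w', a']) :
    ∃ p : G.Walk u v, HasType p (.H 1 2 4 2 1) := by
  have hp' : IsInducedPath G [u, p₁, p₂, p₃, v] := by
    simp only [IsInducedPath, List.mem_cons, List.not_mem_nil, or_false] at *
    grind
  have hb : IsInducedPath G [u, b] := ⟨hbp.1.symm, by simp, trivial⟩
  have hb' : IsInducedPath G [v, b'] := hbp'.2.2.2.2.2.2.2.2.2.2
  obtain ⟨p, hp₀, hpl, hps⟩ := IsInducedPath.exists_handle (l := [p₁, p₂, p₃]) hp' hl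
  obtain ⟨q, hq₀, hql, hqs⟩ := IsInducedPath.exists_handle (l := [w]) ha (by simpa using hw)
  obtain ⟨q', hq₀', hql', hqs'⟩ := IsInducedPath.exists_handle (l := [w']) ha' (by simpa using hw')
  obtain ⟨r, hr₀, hrl, hrs⟩ := IsInducedPath.exists_handle (l := []) hb (by simp)
  obtain ⟨r', hr₀', hrl', hrs'⟩ := IsInducedPath.exists_handle (l := []) hb' (by simp)
  have := G.adj_comm
  have := G.loopless
  refine ⟨p, hp₀, hpl, hu, hv, b, a, a', b', r, q, q', r', ⟨hr₀, hrl⟩, ⟨hq₀, hql⟩, ⟨hq₀', hql'⟩,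
    ⟨hr₀', hrl'⟩, ?_, ?_, ?_, ?_, ?_, ?_, ?_, ?_, ?_, ?_⟩
  all_goals
    refine meetOnlyAtEnds_of_support (fun x hx hx' => ?_) ?_
    · simp only [hps, hqs, hrs, hqs', hrs', List.mem_cons, List.cons_append, List.nil_append,
        List.not_mem_nil, or_false] at hx hx'
      clear hps hqs hrs hqs' hrs' hl
      simp only [IsInducedPath, List.mem_cons, List.not_mem_nil, or_false] at *
      grind
    · clear hps hqs hrs hqs' hrs' hl
      simp only [IsInducedPath, List.mem_cons, List.not_mem_nil, or_false] at *
      grind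

end Walks

/-! ### Degrees in an embedded graph -/

section Embedding

variable {V : Type*} {G : SimpleGraph V} (φ : G ↪g triangularLattice)

theorem deg_eq_encard (v : V) :
    deg G v = {x | x ∈ Set.range φ ∧ triangularLattice.Adj (φ v) x}.encard := by
  rw [deg, ← φ.injective.encard_image]
  congr 1
  ext x
  simp only [Set.mem_image, SimpleGraph.mem_neighborSet, Set.mem_ofPred_eq, Set.mem_range]
  constructor
  · rintro ⟨w, hw, rfl⟩
    exact ⟨⟨w, rfl⟩, φ.map_adj_iff.2 hw⟩
  · rintro ⟨⟨w, rfl⟩, hw⟩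
    exact ⟨w, φ.map_adj_iff.1 hw, rfl⟩

theorem isSparse_range (hG : G.CliqueFree 3) (hdeg : ∀ v, ¬ deg G v ≤ 1) :
    IsSparse (Set.range φ) where
  triangle := by
    rintro _ _ _ ⟨x, rfl⟩ ⟨y, rfl⟩ ⟨z, rfl⟩ hxy hxz hyz
    rw [φ.map_adj_iff] at hxy hxz hyz
    classical
    exact hG {x, y, z} (SimpleGraph.is3Clique_triple_iff.2 ⟨hxy, hxz, hyz⟩)
  two_neighbors := by
    rintro _ ⟨x, rfl⟩
    have h := hdeg x
    rw [not_le, deg, Set.one_lt_encard_iff] at h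
    obtain ⟨y, z, hy, hz, hyz⟩ := h
    exact ⟨φ y, ⟨y, rfl⟩, φ z, ⟨z, rfl⟩, φ.injective.ne hyz, φ.map_adj_iff.2 hy,
      φ.map_adj_iff.2 hz⟩

variable {φ}

theorem IsLink.deg_eq_two (hM : IsSparse (Set.range φ)) {v : V}
    (h : IsLink (Set.range φ) (φ v)) : deg G v = 2 := by
  obtain ⟨y, hy, z, hz, hyz, hxy, hxz⟩ := hM.two_neighbors h.1
  rw [deg_eq_encard φ, ← Set.encard_pair hyz]
  congr 1
  ext x
  constructor
  · rintro ⟨hx, hvx⟩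
    exact h.eq_or_eq hM hy hz hx hxy hxz hvx hyz.symm
  · rintro (rfl | rfl)
    exacts [⟨hy, hxy⟩, ⟨hz, hxz⟩]

theorem IsBranch.deg_eq_three (hM : IsSparse (Set.range φ)) {v : V}
    (h : IsBranch (Set.range φ) (φ v)) : deg G v = 3 := by
  obtain ⟨y, hy, hxy, hl, hr⟩ := h.2
  rw [deg_eq_encard φ, Set.encard_eq_three]
  refine ⟨y, _, _, (turnLeft_ne hxy).symm, (turnRight_ne hxy).symm, turnLeft_ne_turnRight hxy, ?_⟩
  ext x
  constructor
  · rintro ⟨hx, hvx⟩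
    by_cases hxy' : x = y
    · exact .inl hxy'
    · exact .inr (h.eq_of_adj hM hy hx hxy hvx hxy')
  · rintro (rfl | rfl | rfl)
    exacts [⟨hy, hxy⟩, ⟨hl, adj_turnLeft hxy⟩, ⟨hr, adj_turnRight hxy⟩]

/-- Every edge extends to an induced path of length two. -/
theorem IsSparse.exists_isInducedPath (hM : IsSparse (Set.range φ)) {u w : V} (h : G.Adj u w) :
    ∃ a, IsInducedPath G [u, w, a] := by
  obtain ⟨y, hy, z, hz, hyz, hxy, hxz⟩ := hM.two_neighbors ⟨w, rfl⟩
  obtain ⟨a, hwa, hau⟩ : ∃ a, G.Adj w a ∧ a ≠ u := by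
    obtain ⟨y, rfl⟩ := hy
    obtain ⟨z, rfl⟩ := hz
    rw [φ.map_adj_iff] at hxy hxz
    by_cases hyu : y = u
    · exact ⟨z, hxz, fun hzu => hyz (by rw [hyu, hzu])⟩
    · exact ⟨y, hxy, hyu⟩
  refine ⟨a, h, ?_, hwa, by simp, trivial⟩
  simp only [List.mem_cons, List.not_mem_nil, or_false, forall_eq]
  refine ⟨hau, fun hua => hM.triangle ⟨w, rfl⟩ ⟨u, rfl⟩ ⟨a, rfl⟩ (φ.map_adj_iff.2 h.symm)
    (φ.map_adj_iff.2 hwa) (φ.map_adj_iff.2 hua)⟩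

theorem exists_hasType_P_of_range (hM : IsSparse (Set.range φ)) {x y : ℤ × ℤ} {l : List (ℤ × ℤ)}
    (hx : x ∈ Set.range φ) (hl : ∀ z ∈ l, IsLink (Set.range φ) z) (hy : y ∈ Set.range φ)
    (h : IsInducedPath triangularLattice (x :: (l ++ [y]))) :
    ∃ (u v : V) (p : G.Walk u v), HasType p (.P (l.length + 1)) := by
  obtain ⟨u, rfl⟩ := hx
  obtain ⟨v, rfl⟩ := hy
  obtain ⟨l, rfl⟩ : ∃ l' : List V, l'.map φ = l :=
    Set.mem_range.1 (by rw [Set.range_list_map]; exact fun z hz => (hl z hz).1)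
  obtain ⟨p, hp⟩ := exists_hasType_P (G := G) (u := u) (v := v) (l := l)
    ((isInducedPath_map φ _).1 (by simpa using h))
    fun w hw => (hl _ (List.mem_map_of_mem hw)).deg_eq_two hM
  exact ⟨u, v, p, by simpa using hp⟩

theorem exists_hasType_PP_of_range (hM : IsSparse (Set.range φ)) {x y : ℤ × ℤ}
    {l l' : List (ℤ × ℤ)} (hx : x ∈ Set.range φ) (hl : ∀ z ∈ l, IsLink (Set.range φ) z)
    (hy : y ∈ Set.range φ) (hl' : ∀ z ∈ l', z ∈ Set.range φ)
    (h : IsInducedPath triangularLattice (x :: (l ++ [y])))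
    (h' : IsInducedPath triangularLattice (x :: (l' ++ [y])))
    (hlen : l.length = l'.length) (hne : l ≠ []) (hd : ∀ z ∈ l, z ∉ l') :
    ∃ (u v : V) (p : G.Walk u v), HasType p (.PP (l.length + 1)) := by
  obtain ⟨u, rfl⟩ := hx
  obtain ⟨v, rfl⟩ := hy
  obtain ⟨l, rfl⟩ : ∃ k : List V, k.map φ = l :=
    Set.mem_range.1 (by rw [Set.range_list_map]; exact fun z hz => (hl z hz).1)
  obtain ⟨l', rfl⟩ : ∃ k : List V, k.map φ = l' :=
    Set.mem_range.1 (by rw [Set.range_list_map]; exact hl')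
  obtain ⟨p, hp⟩ := exists_hasType_PP (G := G) (u := u) (v := v) (l := l) (l' := l')
    ((isInducedPath_map φ _).1 (by simpa using h))
    (fun w hw => (hl _ (List.mem_map_of_mem hw)).deg_eq_two hM)
    ((isInducedPath_map φ _).1 (by simpa using h')) (by simpa using hlen) (by simpa using hne)
    fun w hw hw' => hd _ (List.mem_map_of_mem hw) (List.mem_map_of_mem hw')
  exact ⟨u, v, p, by simpa using hp⟩

theorem isIrreducible_range (hM : IsSparse (Set.range φ))
    (hno : ∀ t ∈ ({.P 6, .PP 3, .PP 4, .PP 5, .S 5 2 1, .H 1 2 4 2 1} : Set HandleType),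
      ∀ (u v : V) (p : G.Walk u v), ¬ HasType p t) : IsIrreducible (Set.range φ) where
  toIsSparse := hM
  parity_three hu h₁ h₂ hv k₁ k₂ hp hq hd := by
    obtain ⟨u, v, p, h⟩ := exists_hasType_PP_of_range hM (l := [_, _]) (l' := [_, _]) hu
      (by simp [h₁, h₂]) hv (by simp [k₁, k₂, -Set.mem_range]) hp hq rfl (by simp) hd
    exact hno _ (by simp) u v p h
  parity_four hu h₁ h₂ h₃ hv k₁ k₂ k₃ hp hq hd := by
    obtain ⟨u, v, p, h⟩ := exists_hasType_PP_of_range hM (l := [_, _, _]) (l' := [_, _, _]) hu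
      (by simp [h₁, h₂, h₃]) hv (by simp [k₁, k₂, k₃, -Set.mem_range]) hp hq rfl (by simp) hd
    exact hno _ (by simp) u v p h
  parity_five hu h₁ h₂ h₃ h₄ hv k₁ k₂ k₃ k₄ hp hq hd := by
    obtain ⟨u, v, p, h⟩ := exists_hasType_PP_of_range hM (l := [_, _, _, _]) (l' := [_, _, _, _]) hu
      (by simp [h₁, h₂, h₃, h₄]) hv (by simp [k₁, k₂, k₃, k₄, -Set.mem_range]) hp hq rfl
      (by simp) hd
    exact hno _ (by simp) u v p h
  handle_six hu h₁ h₂ h₃ h₄ h₅ hv hp := by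
    obtain ⟨u, v, p, h⟩ := exists_hasType_P_of_range hM (l := [_, _, _, _, _]) hu
      (by simp [h₁, h₂, h₃, h₄, h₅]) hv hp
    exact hno _ (by simp) u v p h
  s_handle hu h₁ h₂ h₃ h₄ hv hw hb hp hwp hbp hwb := by
    obtain ⟨u, rfl⟩ := hu.1
    obtain ⟨p₁, rfl⟩ := h₁.1
    obtain ⟨p₂, rfl⟩ := h₂.1
    obtain ⟨p₃, rfl⟩ := h₃.1
    obtain ⟨p₄, rfl⟩ := h₄.1
    obtain ⟨v, rfl⟩ := hv
    obtain ⟨w, rfl⟩ := hw.1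
    obtain ⟨b, rfl⟩ := hb
    replace hp := (isInducedPath_map φ [_, _, _, _, _, _]).1 hp
    replace hwp := (isInducedPath_map φ [_, _, _, _, _, _]).1 hwp
    replace hbp := (isInducedPath_map φ [_, _, _, _, _, _]).1 hbp
    obtain ⟨a, ha⟩ := hM.exists_isInducedPath hwp.1.symm
    obtain ⟨p, h⟩ := exists_hasType_S (hu.deg_eq_three hM)
      (by simp [h₁.deg_eq_two hM, h₂.deg_eq_two hM, h₃.deg_eq_two hM, h₄.deg_eq_two hM])
      (hw.deg_eq_two hM) hp hwp hbp (fun h => hwb (by rw [h])) ha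
    exact hno _ (by simp) _ _ p h
  h_handle hu h₁ h₂ h₃ hv hw hb hw' hb' hp hbp hbp' hne := by
    obtain ⟨u, rfl⟩ := hu.1
    obtain ⟨p₁, rfl⟩ := h₁.1
    obtain ⟨p₂, rfl⟩ := h₂.1
    obtain ⟨p₃, rfl⟩ := h₃.1
    obtain ⟨v, rfl⟩ := hv.1
    obtain ⟨w, rfl⟩ := hw.1
    obtain ⟨b, rfl⟩ := hb
    obtain ⟨w', rfl⟩ := hw'.1
    obtain ⟨b', rfl⟩ := hb'
    replace hp := (isInducedPath_map φ [_, _, _, _, _, _, _]).1 hp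
    replace hbp := (isInducedPath_map φ [_, _, _, _, _, _, _]).1 hbp
    replace hbp' := (isInducedPath_map φ [_, _, _, _, _, _, _]).1 hbp'
    obtain ⟨a, ha⟩ := hM.exists_isInducedPath hp.1.symm
    have hvw : G.Adj v w' := hp.2.2.2.2.2.2.2.2.2.2.1
    obtain ⟨a', ha'⟩ := hM.exists_isInducedPath hvw
    obtain ⟨p, h⟩ := exists_hasType_H (hu.deg_eq_three hM) (hv.deg_eq_three hM)
      (by simp [h₁.deg_eq_two hM, h₂.deg_eq_two hM, h₃.deg_eq_two hM])
      (hw.deg_eq_two hM) (hw'.deg_eq_two hM) hp hbp hbp' (fun h => hne.1 (by rw [h]))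
      (fun h => hne.2 (by rw [h])) ha ha'
    exact hno _ (by simp) _ _ p h

end Embedding

/-- Every nonempty finite induced subgraph of the triangular lattice can be embedded with its
top-left vertex at the origin. -/
theorem exists_isTopLeft_embedding {V : Type*} [Finite V] [Nonempty V] {G : SimpleGraph V}
    (φ : G ↪g triangularLattice) : ∃ ψ : G ↪g triangularLattice, IsTopLeft (Set.range ψ) := by
  -- Highest row first, then the smallest first coordinate; `v` is then translated to the origin.
  obtain ⟨v, hv⟩ := Finite.exists_max fun v => toLex ((φ v).2, -(φ v).1)
  have hadj : ∀ a b : V, triangularLattice.Adj (φ a - φ v) (φ b - φ v) ↔ G.Adj a b := by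
    intro a b
    rw [adj_iff, sub_sub_sub_cancel_right, ← adj_iff, φ.map_adj_iff]
  refine ⟨⟨⟨fun a => φ a - φ v, fun a b h => φ.injective (sub_left_injective h)⟩, hadj _ _⟩, ?_⟩
  refine ⟨⟨v, sub_self _⟩, ?_, ?_⟩
  · rintro _ ⟨w, rfl⟩
    have := Prod.Lex.le_iff.1 (hv w)
    simp only [ofLex_toLex] at this
    change (φ w).2 - (φ v).2 ≤ 0
    omega
  · rintro _ ⟨w, rfl⟩ h
    have := Prod.Lex.le_iff.1 (hv w)
    simp only [ofLex_toLex] at this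
    change (φ w).2 - (φ v).2 = 0 at h
    change 0 ≤ (φ w).1 - (φ v).1
    omega

theorem exists_hasType_P_two {V : Type*} [Finite V] [Nonempty V] {G : SimpleGraph V}
    (φ : G ↪g triangularLattice) (hG : G.CliqueFree 3) (hdeg : ∀ v, ¬ deg G v ≤ 1) :
    ∃ (u v : V) (p : G.Walk u v), HasType p (.P 2) := by
  obtain ⟨ψ, hT⟩ := exists_isTopLeft_embedding φ
  have hM := isSparse_range ψ hG hdeg
  obtain ⟨h₁, h₂⟩ := hT.neighbors_zero hM
  exact exists_hasType_P_of_range hM (l := [(0, 0)]) h₁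
    (by simpa [-Set.mem_range] using hT.isLink_row_zero hT.zero_mem) h₂ (by decide)

theorem exists_hasType_P_four_or_PP_three {V : Type*} [Finite V] [Nonempty V] {G : SimpleGraph V}
    (φ : G ↪g triangularLattice) (hG : G.CliqueFree 3) (hdeg : ∀ v, ¬ deg G v ≤ 1) :
    ∃ t ∈ ({.P 4, .PP 3} : Set HandleType), ∃ (u v : V) (p : G.Walk u v), HasType p t := by
  obtain ⟨ψ, hT⟩ := exists_isTopLeft_embedding φ
  have hM := isSparse_range ψ hG hdeg
  obtain ⟨h10, ha⟩ := hT.neighbors_zero hM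
  have x0 := hT.isLink_row_zero hT.zero_mem
  have x1 := hT.isLink_row_zero h10
  have hP : ∀ x a b c y, x ∈ Set.range ψ → IsLink (Set.range ψ) a → IsLink (Set.range ψ) b →
      IsLink (Set.range ψ) c → y ∈ Set.range ψ →
      IsInducedPath triangularLattice [x, a, b, c, y] →
      ∃ t ∈ ({.P 4, .PP 3} : Set HandleType), ∃ (u v : V) (p : G.Walk u v), HasType p t :=
    fun x a b c y hx hla hlb hlc hy h => ⟨.P 4, by simp,
      exists_hasType_P_of_range hM (l := [a, b, c]) hx (by simp [hla, hlb, hlc]) hy h⟩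
  obtain hc | h20 | h : (2, -1) ∈ Set.range ψ ∨ (2, 0) ∈ Set.range ψ ∨ (1, 1) ∈ Set.range ψ :=
    hM.next' h10 x0.1
  -- A link at either end of (0, -1), (0, 0), (1, 0), (2, -1) yields P(4). If both ends are branch
  -- points, the hexagon around (1, -1) is complete and yields PP(3).
  · rcases isLink_or_isBranch ha with la | ba
    · obtain h | h | h : (-1, -1) ∈ Set.range ψ ∨ (0, -2) ∈ Set.range ψ ∨
        (1, -2) ∈ Set.range ψ := hM.next' ha x0.1
      all_goals exact hP _ _ _ _ _ h la x0 x1 hc (by decide)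
    rcases isLink_or_isBranch hc with lc | bc
    · obtain h | h | h : (2, -2) ∈ Set.range ψ ∨ (3, -2) ∈ Set.range ψ ∨
        (3, -1) ∈ Set.range ψ := hM.next' hc h10
      all_goals exact hP _ _ _ _ _ ha x0 x1 lc h (by decide)
    obtain ⟨-, h₁⟩ : (-1, -1) ∈ Set.range ψ ∧ (1, -2) ∈ Set.range ψ := ba.turn' hM x0.1
    obtain ⟨h₂, -⟩ : (2, -2) ∈ Set.range ψ ∧ (3, -1) ∈ Set.range ψ := bc.turn' hM h10
    exact ⟨.PP 3, by simp, exists_hasType_PP_of_range hM (l := [(0, 0), (1, 0)])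
      (l' := [(1, -2), (2, -2)]) ha (by simp [x0, x1]) hc (by simp [h₁, h₂, -Set.mem_range])
      (by decide) (by decide) rfl (by simp) (by decide)⟩
  · have x2 := hT.isLink_row_zero h20
    obtain h | h | h : (3, -1) ∈ Set.range ψ ∨ (3, 0) ∈ Set.range ψ ∨ (2, 1) ∈ Set.range ψ :=
      hM.next' h20 h10
    · exact hP _ _ _ _ _ ha x0 x1 x2 h (by decide)
    · exact hP _ _ _ _ _ ha x0 x1 x2 h (by decide)
    · exact absurd h hT.not_mem_above
  · exact absurd h hT.not_mem_above

theorem exists_hasType_P_six_or_other {V : Type*} [Finite V] [Nonempty V]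
    {G : SimpleGraph V} (φ : G ↪g triangularLattice) (hG : G.CliqueFree 3)
    (hdeg : ∀ v, ¬ deg G v ≤ 1) :
    ∃ t ∈ ({.P 6, .PP 3, .PP 4, .PP 5, .S 5 2 1, .H 1 2 4 2 1} : Set HandleType),
      ∃ (u v : V) (p : G.Walk u v), HasType p t := by
  obtain ⟨ψ, hT⟩ := exists_isTopLeft_embedding φ
  by_contra! hno
  exact (isIrreducible_range (isSparse_range ψ hG hdeg) hno).not_isTopLeft hT

/-! ### Cores -/

/-- A handle type all of whose handles have an interior vertex. -/
def HandleType.IsProper : HandleType → Prop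
  | .P n => 2 ≤ n
  | .PP n => 2 ≤ n
  | .S n _ _ => 2 ≤ n
  | .H _ _ n _ _ => 2 ≤ n

theorem interior_nonempty {V : Type*} {G : SimpleGraph V} {u v : V} {p : G.Walk u v}
    (hp : p.IsPath) (h : 2 ≤ p.length) : (interior p).Nonempty := by
  cases p with
  | nil => simp at h
  | @cons _ w _ huw q =>
    rw [SimpleGraph.Walk.cons_isPath_iff] at hp
    refine ⟨w, by simp, huw.ne', ?_⟩
    rintro rfl
    have := (SimpleGraph.Walk.isPath_iff_nil.1 hp.1).length_eq_zero
    simp [this] at h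

theorem HasType.interior_nonempty {V : Type*} {G : SimpleGraph V} {u v : V} {p : G.Walk u v}
    {t : HandleType} (h : HasType p t) (ht : t.IsProper) : (interior p).Nonempty := by
  have hlen : 2 ≤ p.length := by
    cases t with
    | P n => exact h.2.symm ▸ ht
    | PP n => exact h.2.1.symm ▸ ht
    | S n _ _ => exact h.2.1.symm ▸ ht
    | H _ _ n _ _ => exact h.2.1.symm ▸ ht
  refine HandleReduction.interior_nonempty ?_ hlen
  cases t <;> exact h.1.1

theorem Step.ssubset {V : Type*} {G : SimpleGraph V} {F : Set HandleType}
    (hF : ∀ t ∈ F, t.IsProper) {A B : Set V} (h : Step F G A B) : B ⊂ A := by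
  cases h with
  | lowDegree v hv => exact Set.sdiff_singleton_ssubset.2 v.2
  | handle t ht u v p hp =>
    obtain ⟨w, hw⟩ := hp.interior_nonempty (hF t ht)
    exact ⟨Set.sdiff_subset, fun h => (h w.2).2 ⟨w, hw, rfl⟩⟩

theorem exists_reflTransGen_irreducible {V : Type*} [Finite V] {G : SimpleGraph V}
    {F : Set HandleType} (hF : ∀ t ∈ F, t.IsProper) (A : Set V) :
    ∃ B, Relation.ReflTransGen (Step F G) A B ∧ ∀ C, ¬ Step F G B C := by
  induction A using (wellFounded_lt (α := Set V)).induction with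
  | _ A ih =>
    by_cases h : ∃ B, Step F G A B
    · obtain ⟨B, hB⟩ := h
      obtain ⟨C, hBC, hC⟩ := ih B (hB.ssubset hF)
      exact ⟨C, .head hB hBC, hC⟩
    · exact ⟨A, .refl, fun B hB => h ⟨B, hB⟩⟩

/-- If every nonempty induced subgraph of minimum degree two of a finite graph has a handle of a
type in `F`, then the empty set is the only core. -/
theorem isCore_iff_eq_empty {V : Type*} [Finite V] {G : SimpleGraph V} {F : Set HandleType}
    (hF : ∀ t ∈ F, t.IsProper)
    (h : ∀ A : Set V, A.Nonempty → (∀ v, ¬ deg (G.induce A) v ≤ 1) →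
      ∃ t ∈ F, ∃ (u v : A) (p : (G.induce A).Walk u v), HasType p t) (A : Set V) :
    IsCore F G A ↔ A = ∅ := by
  have key : ∀ B : Set V, (∀ C, ¬ Step F G B C) → B = ∅ := by
    intro B hB
    by_contra hne
    obtain ⟨t, ht, u, v, p, hp⟩ := h B (Set.nonempty_iff_ne_empty.2 hne)
      fun v hv => hB _ (.lowDegree B v hv)
    exact hB _ (.handle B t ht u v p hp)
  constructor
  · exact fun hA => key A hA.2
  · rintro rfl
    -- Reductions of the whole graph terminate, and the irreducible set they reach is empty by
    -- `key`; hence the empty set is itself reached.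
    obtain ⟨B, hB, hirr⟩ := exists_reflTransGen_irreducible (G := G) hF Set.univ
    obtain rfl := key B hirr
    exact ⟨hB, hirr⟩

end HandleReduction

theorem mainTheorem5 {V : Type*} (G : SimpleGraph V) (hG : HandleReduction.IsHexagonal G) :
    (∀ A : Set V, HandleReduction.IsCore {.P 2} G A ↔ A = ∅) ∧
    (∀ A : Set V, HandleReduction.IsCore {.P 4, .PP 3} G A ↔ A = ∅) ∧
    (∀ A : Set V, HandleReduction.IsCore
      {.P 6, .PP 3, .PP 4, .PP 5, .S 5 2 1, .H 1 2 4 2 1} G A ↔ A = ∅) := by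
  obtain ⟨hfin, ⟨φ⟩, hcf⟩ := hG
  have emb (A : Set V) : G.induce A ↪g HandleReduction.triangularLattice :=
    (SimpleGraph.Embedding.induce A).trans φ
  have hcf' (A : Set V) : (G.induce A).CliqueFree 3 :=
    hcf.comap (SimpleGraph.Embedding.induce A).isContained
  open HandleReduction in
  refine ⟨isCore_iff_eq_empty (by simp [HandleType.IsProper]) fun A hA hdeg => ?_,
    isCore_iff_eq_empty (by simp [HandleType.IsProper]) fun A hA hdeg => ?_,
    isCore_iff_eq_empty (by simp [HandleType.IsProper]) fun A hA hdeg => ?_⟩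
  · have := hA.to_subtype
    exact ⟨_, rfl, HandleReduction.exists_hasType_P_two (emb A) (hcf' A) hdeg⟩
  · have := hA.to_subtype
    exact HandleReduction.exists_hasType_P_four_or_PP_three (emb A) (hcf' A) hdeg
  · have := hA.to_subtype
    exact HandleReduction.exists_hasType_P_six_or_other (emb A) (hcf' A) hdeg
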